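/- Let $v:\mathbb{R}^3\to\mathbb{R}^3$ be continuously differentiable, and let $g:\mathbb{R}^3\to\mathbb{R}$ be continuous, continuously differentiable in a neighbourhood of every point of $\{g=0\}$, with $\nabla g(x)\neq 0$ whenever $g(x)=0$. For $x,u\in\mathbb{R}^3$ put $h(u)=u_1^2+u_2^2+u_3^2-1$ and $\Gamma(x,u)=\langle\nabla g(x),\,u+v(x)\rangle$. Assume the regularity condition: for all $x,u\in\mathbb{R}^3$ with $g(x)=0$, $\Gamma(x,u)=0$ and $h(u)=0$, the two vectors $\frac{\partial\Gamma}{\partial u}(x,u)$ and $\nabla h(u)$ are linearly independent. Assume moreover that $|v(x)|<1$ (Euclidean norm) for all $x$ with $g(x)<0$, and that the points $A$ and $B$ belong to the same connected component of the feasible state domain $\{x\in\mathbb{R}^3: g(x)\le 0\}$. Then the time-optimal control problem of minimizing $T\ge 0$ subject to $$\dot x(t)=u(t)+v(x(t))\ \text{ for a.e. } t\in[0,T],\quad x(0)=A,\quad x(T)=B,\quad g(x(t))\le 0,\quad h(u(t))\le 0\ \text{ for all } t\in[0,T],$$ over absolutely continuous $x:[0,T]\to\mathbb{R}^3$ and measurable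 controls $u:[0,T]\to\mathbb{R}^3$, has a solution; that is, there is an admissible triple $(T^*,x^*,u^*)$ such that $T^*\le T$ for every admissible triple $(T,x,u)$. -/

import Mathlib

open MeasureTheory Set

noncomputable section

/-- Three-dimensional Euclidean space. -/
abbrev E3 : Type := EuclideanSpace ℝ (Fin 3)

/-- The function `h` of the control constraint `h u ≤ 0`. -/
def ctrlConstraint (u : E3) : ℝ := u 0 ^ 2 + u 1 ^ 2 + u 2 ^ 2 - 1

/-- The scalar product of the dynamics with the gradient of the state constraint function. -/
def Gam (g : E3 → ℝ) (v : E3 → E3) (x u : E3) : ℝ := inner ℝ (gradient g x) (u + v x)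

/-- The regularity condition: at all `x`, `u` with `g x = 0`, `Gam g v x u = 0`, `h u = 0`,
the two vectors `∂Γ/∂u (x, u)` and `∇ h u` are linearly independent. -/
def RegularityCondition (g : E3 → ℝ) (v : E3 → E3) : Prop :=
  ∀ x u : E3, g x = 0 → Gam g v x u = 0 → ctrlConstraint u = 0 →
    LinearIndependent ℝ ![gradient (fun w : E3 => Gam g v x w) u, gradient ctrlConstraint u]

/-- The feasible state domain. -/
def feasibleSet (g : E3 → ℝ) : Set E3 := {x | g x ≤ 0}

/-- `(T, x, u)` is an admissible process of the time-optimal problem with data `g`, `v`, `A`, `B`.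
Only the values of `x` and `u` on `[0, T]` matter. -/
structure IsFeasibleProcess (g : E3 → ℝ) (v : E3 → E3) (A B : E3)
    (T : ℝ) (x u : ℝ → E3) : Prop where
  time_nonneg : 0 ≤ T
  control_measurable : AEMeasurable u (volume.restrict (Icc 0 T))
  control_mem : ∀ t ∈ Icc 0 T, ctrlConstraint (u t) ≤ 0
  state_absCont : AbsolutelyContinuousOnInterval x 0 T
  dynamics : ∀ᵐ t ∂(volume.restrict (Icc 0 T)), HasDerivAt x (u t + v (x t)) t
  initial : x 0 = A
  terminal : x T = B
  state_mem : ∀ t ∈ Icc 0 T, g (x t) ≤ 0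

/-- `(T, x, u)` solves the time-optimal problem: it is an admissible process, and no admissible
process has a smaller terminal time. -/
def IsOptimalProcess (g : E3 → ℝ) (v : E3 → E3) (A B : E3)
    (T : ℝ) (x u : ℝ → E3) : Prop :=
  IsFeasibleProcess g v A B T x u ∧
    ∀ (T' : ℝ) (x' u' : ℝ → E3), IsFeasibleProcess g v A B T' x' u' → T ≤ T'

end

open Filter Topology NNReal

/-! The drift bound extends to `‖v‖ ≤ 1` on the whole feasible set, so feasible trajectories are
2-Lipschitz, and an optimum exists once some trajectory joins `A` to `B`.

Controllability: `Reach` is transitive, so by connectedness it suffices to join each feasible point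
to all nearby feasible points, in both directions. Where `g < 0` the control beats the drift. Where
`g = 0`, regularity makes the normal component of the drift shorter than 1, so that the boundary can
be both left and approached through the interior (`eventually_reach_of_eq_zero`).

Compactness: admissible velocities form the unit ball about `v x`. Since balls are convex, the
constraint has an integrated form that survives pointwise limits
(`norm_sub_sub_smul_le_of_ae_velocity`), so a limit of a minimizing sequence is again a trajectory
(`exists_isTrajectory_minimal`). -/

/-! ### Lipschitz and absolutely continuous curves -/

theorem LipschitzOnWith.of_dist_le_mul_sub {X : Type*} [PseudoMetricSpace X] {f : ℝ → X}
    {K : ℝ≥0} {S : Set ℝ} (h : ∀ s ∈ S, ∀ t ∈ S, s ≤ t → dist (f s) (f t) ≤ K * (t - s)) :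
    LipschitzOnWith K f S := by
  refine LipschitzOnWith.of_dist_le_mul fun s hs t ht => ?_
  rcases le_total s t with hst | hst
  · rw [dist_comm s, Real.dist_eq, abs_of_nonneg (sub_nonneg.2 hst)]
    exact h s hs t ht hst
  · rw [dist_comm, Real.dist_eq, abs_of_nonneg (sub_nonneg.2 hst)]
    exact h t ht s hs hst

theorem LipschitzOnWith.dist_le_mul_sub {X : Type*} [PseudoMetricSpace X] {f : ℝ → X}
    {K : ℝ≥0} {S : Set ℝ} (h : LipschitzOnWith K f S) {s t : ℝ} (hs : s ∈ S) (ht : t ∈ S)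
    (hst : s ≤ t) : dist (f s) (f t) ≤ K * (t - s) := by
  have := h.dist_le_mul s hs t ht
  rwa [dist_comm s, Real.dist_eq, abs_of_nonneg (sub_nonneg.2 hst)] at this

theorem AbsolutelyContinuousOnInterval.inner_const_left {E : Type*} [NormedAddCommGroup E]
    [InnerProductSpace ℝ E] {f : ℝ → E} {a b : ℝ} (hf : AbsolutelyContinuousOnInterval f a b)
    (e : E) : AbsolutelyContinuousOnInterval (fun t => inner ℝ e (f t)) a b := by
  have h := Filter.Tendsto.const_mul ‖e‖ hf
  rw [mul_zero] at h
  refine squeeze_zero (fun I => Finset.sum_nonneg fun i _ => dist_nonneg) (fun I => ?_) h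
  rw [Finset.mul_sum]
  refine Finset.sum_le_sum fun i _ => ?_
  rw [Real.dist_eq, ← inner_sub_right, dist_eq_norm]
  exact abs_real_inner_le_norm _ _

/-- Mean value inequality for absolutely continuous curves. -/
theorem AbsolutelyContinuousOnInterval.norm_sub_le_of_ae_hasDerivAt {E : Type*}
    [NormedAddCommGroup E] [InnerProductSpace ℝ E] {f : ℝ → E} {a b C : ℝ} (hab : a ≤ b)
    (hf : AbsolutelyContinuousOnInterval f a b)
    (hd : ∀ᵐ t ∂(volume.restrict (Icc a b)), ∃ d, HasDerivAt f d t ∧ ‖d‖ ≤ C) :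
    ‖f b - f a‖ ≤ C * (b - a) := by
  -- Pairing with the increment itself reduces the claim to a scalar integral.
  set e := f b - f a with he
  have hφ := hf.inner_const_left e
  have hint := hφ.integral_deriv_eq_sub
  have hbound : ‖∫ t in a..b, deriv (fun t => inner ℝ e (f t)) t‖ ≤ ‖e‖ * C * |b - a| := by
    refine intervalIntegral.norm_integral_le_of_norm_le_const_ae ?_
    have hd' := (ae_restrict_iff' measurableSet_Icc).1 hd
    filter_upwards [hd'] with t ht hmem
    rw [uIoc_of_le hab] at hmem
    obtain ⟨d, hd, hdC⟩ := ht ⟨hmem.1.le, hmem.2⟩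
    have h1 : HasDerivAt (fun t => inner ℝ e (f t)) (inner ℝ e d) t := by
      simpa using (hasDerivAt_const t e).inner ℝ hd
    rw [h1.deriv]
    calc ‖inner ℝ e d‖ ≤ ‖e‖ * ‖d‖ := norm_inner_le_norm e d
      _ ≤ ‖e‖ * C := by gcongr
  rw [hint, ← inner_sub_right, ← he, real_inner_self_eq_norm_sq, abs_of_nonneg (sub_nonneg.2 hab),
    Real.norm_of_nonneg (sq_nonneg _)] at hbound
  rcases (norm_nonneg e).eq_or_lt with h0 | h0
  · rcases hab.eq_or_lt with h | h
    · simp [← h0, h]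
    · have hC : 0 ≤ C := by
        by_contra! hC
        have : volume.restrict (Icc a b) = 0 := by
          rw [← ae_eq_bot, ← Filter.empty_mem_iff_bot]
          filter_upwards [hd] with t ht
          obtain ⟨d, _, hd⟩ := ht
          exact absurd (norm_nonneg d) (by linarith)
        simp [Measure.restrict_eq_zero] at this
        linarith
      rw [← h0]
      exact mul_nonneg hC (by linarith)
  · refine le_of_mul_le_mul_left ?_ h0
    nlinarith

/-! ### The control constraint and the drift at the boundary -/

theorem ctrlConstraint_eq (u : E3) : ctrlConstraint u = ‖u‖ ^ 2 - 1 := by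
  simp [ctrlConstraint, EuclideanSpace.real_norm_sq_eq, Fin.sum_univ_three]

theorem ctrlConstraint_nonpos_iff (u : E3) : ctrlConstraint u ≤ 0 ↔ ‖u‖ ≤ 1 := by
  rw [ctrlConstraint_eq, sub_nonpos, sq_le_one_iff₀ (norm_nonneg u)]

theorem gradient_ctrlConstraint (u : E3) : gradient ctrlConstraint u = (2 : ℝ) • u := by
  have h : HasFDerivAt ctrlConstraint (2 • innerSL ℝ u) u := by
    have h := (hasStrictFDerivAt_norm_sq u).hasFDerivAt.sub_const 1
    exact h.congr_of_eventuallyEq (Eventually.of_forall ctrlConstraint_eq)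
  refine HasGradientAt.gradient (hasGradientAt_iff_hasFDerivAt.2 ?_)
  refine h.congr_fderiv ?_
  ext w
  simp [two_mul]

theorem gradient_Gam (g : E3 → ℝ) (v : E3 → E3) (x u : E3) :
    gradient (fun w : E3 => Gam g v x w) u = gradient g x := by
  refine HasGradientAt.gradient (hasGradientAt_iff_hasFDerivAt.2 ?_)
  have h := ((innerSL ℝ (gradient g x)).hasFDerivAt (x := u)).add_const (inner ℝ (gradient g x) (v x))
  refine (h.congr_of_eventuallyEq (Eventually.of_forall fun w => ?_)).congr_fderiv ?_
  · simp [Gam, inner_add_right]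
  · ext w
    simp

/-- On the boundary, regularity excludes drift whose normal component has unit length. -/
theorem RegularityCondition.abs_inner_gradient_lt {g : E3 → ℝ} {v : E3 → E3}
    (hreg : RegularityCondition g v) {x : E3} (hx : g x = 0) (hp : gradient g x ≠ 0)
    (hvx : ‖v x‖ ≤ 1) : |inner ℝ (gradient g x) (v x)| < ‖gradient g x‖ := by
  set p := gradient g x with hpdef
  have hp0 : 0 < ‖p‖ := norm_pos_iff.2 hp
  refine lt_of_le_of_ne ((abs_real_inner_le_norm _ _).trans
    (mul_le_of_le_one_right hp0.le hvx)) fun h => ?_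
  obtain ⟨σ, hσ, hin⟩ : ∃ σ : ℝ, |σ| = 1 ∧ inner ℝ p (v x) = σ * ‖p‖ := by
    rcases abs_choice (inner ℝ p (v x)) with h' | h'
    · exact ⟨1, by simp, by linarith⟩
    · exact ⟨-1, by simp, by linarith⟩
  -- In case of equality, the unit control opposite to the normal part of the drift gives `Γ = 0`,
  -- yet `∇h = 2u` is parallel to `∇g`.
  have hli := hreg x ((-σ * ‖p‖⁻¹) • p) hx ?_ ?_
  · rw [gradient_Gam, gradient_ctrlConstraint, LinearIndependent.pair_iff] at hli
    have := (hli (2 * (σ * ‖p‖⁻¹)) 1 (by rw [← hpdef]; module)).2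
    exact one_ne_zero this
  · rw [Gam, inner_add_right, inner_smul_right, real_inner_self_eq_norm_sq, ← hpdef, hin]
    field_simp
    ring
  · rw [ctrlConstraint_eq, norm_smul, norm_mul, norm_neg, Real.norm_eq_abs, hσ, norm_inv, norm_norm]
    field_simp
    ring

/-- The drift bound of the open domain extends to the boundary. -/
theorem norm_drift_le_one {g : E3 → ℝ} {v : E3 → E3} (hv : Continuous v)
    (hgrad : ∀ x : E3, g x = 0 → gradient g x ≠ 0) (hvlt : ∀ x : E3, g x < 0 → ‖v x‖ < 1)
    {x : E3} (hx : g x ≤ 0) : ‖v x‖ ≤ 1 := by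
  rcases hx.lt_or_eq with h | h
  · exact (hvlt x h).le
  by_contra! hlt
  refine hgrad x h ?_
  have hmin : IsLocalMin g x := by
    filter_upwards [hv.norm.continuousAt.eventually (lt_mem_nhds hlt)] with y hy
    rw [h]
    by_contra! hneg
    exact (hvlt y hneg).not_gt hy
  rw [gradient, hmin.fderiv_eq_zero, map_zero]

/-! ### Trajectories without controls -/

/-- A feasible trajectory from `a` to `b` of duration `T`: the control is eliminated. -/
structure IsTrajectory (g : E3 → ℝ) (v : E3 → E3) (a b : E3) (T : ℝ) (x : ℝ → E3) : Prop where
  time_nonneg : 0 ≤ T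
  lipschitz : LipschitzOnWith 2 x (Icc 0 T)
  velocity : ∀ᵐ t ∂(volume.restrict (Icc 0 T)), ∃ d, HasDerivAt x d t ∧ ‖d - v (x t)‖ ≤ 1
  initial : x 0 = a
  terminal : x T = b
  state_mem : ∀ t ∈ Icc 0 T, g (x t) ≤ 0

/-- The control is `deriv x - v ∘ x`, reset to `0` where it is too long, because the control
constraint must hold at every time and not just almost everywhere. -/
theorem IsTrajectory.exists_isFeasibleProcess {g : E3 → ℝ} {v : E3 → E3} {a b : E3} {T : ℝ}
    {x : ℝ → E3} (hv : Continuous v) (h : IsTrajectory g v a b T x) :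
    ∃ u, IsFeasibleProcess g v a b T x u := by
  classical
  refine ⟨fun t => if ‖deriv x t - v (x t)‖ ≤ 1 then deriv x t - v (x t) else 0,
    h.time_nonneg, ?_, ?_, ?_, ?_, h.initial, h.terminal, h.state_mem⟩
  · have hx : AEMeasurable x (volume.restrict (Icc 0 T)) :=
      h.lipschitz.continuousOn.aemeasurable measurableSet_Icc
    have hw : AEMeasurable (fun t => deriv x t - v (x t)) (volume.restrict (Icc 0 T)) :=
      (measurable_deriv x).aemeasurable.sub (hv.measurable.comp_aemeasurable hx)
    have hclip : Measurable fun w : E3 => if ‖w‖ ≤ 1 then w else 0 :=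
      Measurable.ite (measurableSet_le measurable_norm measurable_const) measurable_id
        measurable_const
    exact hclip.comp_aemeasurable hw
  · intro t _
    rw [ctrlConstraint_nonpos_iff]
    split_ifs with h'
    · exact h'
    · simp
  · refine LipschitzOnWith.absolutelyContinuousOnInterval (K := 2) ?_
    rw [uIcc_of_le h.time_nonneg]
    exact h.lipschitz
  · filter_upwards [h.velocity] with t ht
    obtain ⟨d, hd, hd1⟩ := ht
    rw [hd.deriv, if_pos hd1, sub_add_cancel]
    exact hd

/-- Integrated velocity constraint: it involves no derivative of `x`, hence passes to pointwise
limits. -/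
theorem norm_sub_sub_smul_le_of_ae_velocity {v : E3 → E3} {x : ℝ → E3} {T s t ε : ℝ}
    {c : E3} (hx : AbsolutelyContinuousOnInterval x 0 T)
    (hvel : ∀ᵐ t ∂(volume.restrict (Icc 0 T)), ∃ d, HasDerivAt x d t ∧ ‖d - v (x t)‖ ≤ 1)
    (hs : 0 ≤ s) (hst : s ≤ t) (ht : t ≤ T)
    (hc : ∀ r ∈ Icc s t, ‖v (x r) - c‖ ≤ ε) :
    ‖x t - x s - (t - s) • c‖ ≤ (1 + ε) * (t - s) := by
  have hsub : Icc s t ⊆ Icc 0 T := Icc_subset_Icc hs ht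
  have hlin : AbsolutelyContinuousOnInterval (fun r : ℝ => r • c) s t := by
    refine LipschitzOnWith.absolutelyContinuousOnInterval (K := ‖c‖₊)
      (LipschitzWith.of_dist_le_mul fun r r' => ?_).lipschitzOnWith
    rw [dist_eq_norm, ← sub_smul, norm_smul, dist_eq_norm, coe_nnnorm, mul_comm]
  have hac : AbsolutelyContinuousOnInterval (fun r => x r - r • c) s t :=
    (hx.mono (by rwa [uIcc_of_le hst, uIcc_of_le (hs.trans (hst.trans ht))])).sub hlin
  have key := hac.norm_sub_le_of_ae_hasDerivAt (C := 1 + ε) hst ?_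
  · rwa [show x t - t • c - (x s - s • c) = x t - x s - (t - s) • c by module] at key
  · filter_upwards [ae_restrict_of_ae_restrict_of_subset hsub hvel,
      ae_restrict_mem measurableSet_Icc] with r hr hmem
    obtain ⟨d, hd, hd1⟩ := hr
    refine ⟨d - c, by simpa using hd.fun_sub ((hasDerivAt_id r).smul_const c), ?_⟩
    calc ‖d - c‖ = ‖(d - v (x r)) + (v (x r) - c)‖ := by congr 1; abel
      _ ≤ 1 + ε := (norm_add_le _ _).trans (add_le_add hd1 (hc r hmem))

theorem IsFeasibleProcess.isTrajectory {g : E3 → ℝ} {v : E3 → E3} {a b : E3} {T : ℝ}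
    {x u : ℝ → E3} (hv1 : ∀ y, g y ≤ 0 → ‖v y‖ ≤ 1) (h : IsFeasibleProcess g v a b T x u) :
    IsTrajectory g v a b T x := by
  have hvel : ∀ᵐ t ∂(volume.restrict (Icc 0 T)), ∃ d, HasDerivAt x d t ∧ ‖d - v (x t)‖ ≤ 1 := by
    filter_upwards [h.dynamics, ae_restrict_mem measurableSet_Icc] with t ht hmem
    refine ⟨_, ht, ?_⟩
    rw [add_sub_cancel_right]
    exact (ctrlConstraint_nonpos_iff _).1 (h.control_mem t hmem)
  refine ⟨h.time_nonneg, LipschitzOnWith.of_dist_le_mul_sub fun s hs t ht hst => ?_, hvel,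
    h.initial, h.terminal, h.state_mem⟩
  have := norm_sub_sub_smul_le_of_ae_velocity (c := 0) (ε := 1) h.state_absCont hvel hs.1 hst ht.2
    fun r hr => by simpa using hv1 _ (h.state_mem r ⟨hs.1.trans hr.1, hr.2.trans ht.2⟩)
  rw [smul_zero, sub_zero, one_add_one_eq_two] at this
  rwa [dist_comm, dist_eq_norm]

/-! ### Controllability -/

/-- `b` can be reached from `a` along a feasible trajectory. -/
def Reach (g : E3 → ℝ) (v : E3 → E3) (a b : E3) : Prop :=
  ∃ T x, IsTrajectory g v a b T x

theorem Reach.trans {g : E3 → ℝ} {v : E3 → E3} {a b c : E3} (hab : Reach g v a b)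
    (hbc : Reach g v b c) : Reach g v a c := by
  obtain ⟨T, x, hx⟩ := hab
  obtain ⟨S, y, hy⟩ := hbc
  have hT := hx.time_nonneg
  have hS := hy.time_nonneg
  set z : ℝ → E3 := fun t => if t ≤ T then x t else y (t - T) with hz
  have hzl : ∀ t ≤ T, z t = x t := fun t ht => if_pos ht
  have hzr : ∀ t, T ≤ t → z t = y (t - T) := by
    intro t ht
    rcases ht.eq_or_lt with rfl | h
    · rw [hzl _ le_rfl, sub_self, hx.terminal, hy.initial]
    · exact if_neg h.not_ge
  refine ⟨T + S, z, by positivity, ?_, ?_, ?_, ?_, ?_⟩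
  · refine LipschitzOnWith.of_dist_le_mul_sub fun s hs t ht hst => ?_
    rcases le_total t T with h | h
    · rw [hzl _ h, hzl _ (hst.trans h)]
      exact hx.lipschitz.dist_le_mul_sub ⟨hs.1, hst.trans h⟩ ⟨ht.1, h⟩ hst
    have hty : t - T ∈ Icc 0 S := ⟨by linarith, by linarith [ht.2]⟩
    rcases le_total s T with h' | h'
    · rw [hzl _ h', hzr _ h]
      have h1 := hx.lipschitz.dist_le_mul_sub ⟨hs.1, h'⟩ ⟨hT, le_rfl⟩ h'
      have h2 := hy.lipschitz.dist_le_mul_sub ⟨le_rfl, hS⟩ hty hty.1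
      rw [hx.terminal] at h1
      rw [hy.initial] at h2
      refine (dist_triangle _ b _).trans ((add_le_add h1 h2).trans_eq ?_)
      ring
    · rw [hzr _ h', hzr _ h]
      have := hy.lipschitz.dist_le_mul_sub ⟨by linarith, by linarith [hs.2]⟩ hty
        (sub_le_sub_right hst T)
      rwa [sub_sub_sub_cancel_right] at this
  · rw [ae_restrict_iff' measurableSet_Icc]
    have h1 := (ae_restrict_iff' measurableSet_Icc).1 hx.velocity
    have h2 := (measurePreserving_sub_right volume T).quasiMeasurePreserving.ae
      ((ae_restrict_iff' measurableSet_Icc).1 hy.velocity)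
    have h3 : ∀ᵐ t : ℝ, t ≠ T := by simp [ae_iff]
    filter_upwards [h1, h2, h3] with t ht1 ht2 ht3 hmem
    rcases ht3.lt_or_gt with h | h
    · obtain ⟨d, hd, hd1⟩ := ht1 ⟨hmem.1, h.le⟩
      refine ⟨d, hd.congr_of_eventuallyEq ?_, by rwa [hzl _ h.le]⟩
      filter_upwards [gt_mem_nhds h] with r hr using hzl _ hr.le
    · obtain ⟨d, hd, hd1⟩ := ht2 ⟨by linarith, by linarith [hmem.2]⟩
      refine ⟨d, (hd.comp_sub_const t T).congr_of_eventuallyEq ?_, by rwa [hzr _ h.le]⟩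
      filter_upwards [lt_mem_nhds h] with r hr using hzr _ hr.le
  · rw [hzl _ hT, hx.initial]
  · rw [hzr _ (by linarith), add_sub_cancel_left, hy.terminal]
  · intro t ht
    rcases le_total t T with h | h
    · rw [hzl _ h]
      exact hx.state_mem t ⟨ht.1, h⟩
    · rw [hzr _ h]
      exact hy.state_mem _ ⟨by linarith, by linarith [ht.2]⟩

theorem Reach.of_const_velocity {g : E3 → ℝ} {v : E3 → E3} (hv1 : ∀ y, g y ≤ 0 → ‖v y‖ ≤ 1)
    {a w : E3} {τ : ℝ} (hτ : 0 ≤ τ) (hg : ∀ t ∈ Icc 0 τ, g (a + t • w) ≤ 0)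
    (hw : ∀ t ∈ Icc 0 τ, ‖w - v (a + t • w)‖ ≤ 1) : Reach g v a (a + τ • w) := by
  have hw2 : ‖w‖ ≤ 2 := by
    have h0 : (0 : ℝ) ∈ Icc 0 τ := ⟨le_rfl, hτ⟩
    have := norm_le_norm_sub_add w (v (a + (0 : ℝ) • w))
    linarith [hw 0 h0, hv1 _ (hg 0 h0)]
  refine ⟨τ, fun t => a + t • w, hτ, ?_, ?_, by simp, rfl, hg⟩
  · refine (LipschitzWith.of_dist_le_mul fun r r' => ?_).lipschitzOnWith
    rw [dist_add_left, dist_eq_norm, ← sub_smul, norm_smul, dist_eq_norm, mul_comm]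
    exact mul_le_mul_of_nonneg_right hw2 (norm_nonneg _)
  · filter_upwards [ae_restrict_mem measurableSet_Icc] with t ht
    exact ⟨w, by simpa using ((hasDerivAt_id t).smul_const w).const_add a, hw t ht⟩

/-- Inside the open domain the drift is dominated, so that segments can be followed slowly. -/
theorem Reach.of_segment {g : E3 → ℝ} {v : E3 → E3} (hv : Continuous v)
    (hvlt : ∀ x : E3, g x < 0 → ‖v x‖ < 1) (hv1 : ∀ y, g y ≤ 0 → ‖v y‖ ≤ 1)
    {a b : E3} (h : ∀ s ∈ Icc (0 : ℝ) 1, g (a + s • (b - a)) < 0) : Reach g v a b := by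
  obtain ⟨s₀, hs₀, hmax⟩ := isCompact_Icc.exists_isMaxOn (nonempty_Icc.2 (zero_le_one (α := ℝ)))
    (f := fun s : ℝ => ‖v (a + s • (b - a))‖) (by fun_prop)
  set ε := 1 - ‖v (a + s₀ • (b - a))‖ with hε
  have hε0 : 0 < ε := sub_pos.2 (hvlt _ (h s₀ hs₀))
  -- The `+ 1` covers the case `a = b`.
  set k := ε / (‖b - a‖ + 1) with hk
  have hk0 : 0 < k := by positivity
  have hkb : k * ‖b - a‖ ≤ ε := by
    rw [hk, div_mul_eq_mul_div, div_le_iff₀ (by positivity)]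
    nlinarith
  have hscale : ∀ t ∈ Icc 0 k⁻¹, t * k ∈ Icc (0 : ℝ) 1 := fun t ht =>
    ⟨mul_nonneg ht.1 hk0.le, by
      have := mul_le_mul_of_nonneg_right ht.2 hk0.le
      rwa [inv_mul_cancel₀ hk0.ne'] at this⟩
  have := Reach.of_const_velocity hv1 (a := a) (w := k • (b - a)) (inv_nonneg.2 hk0.le)
    (fun t ht => by rw [smul_smul]; exact (h _ (hscale t ht)).le)
    (fun t ht => by
      rw [smul_smul]
      refine (norm_sub_le _ _).trans ?_
      rw [norm_smul, Real.norm_of_nonneg hk0.le]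
      have := hmax (hscale t ht)
      simp only [mem_ofPred_eq] at this
      linarith)
  rwa [smul_smul, inv_mul_cancel₀ hk0.ne', one_smul, add_sub_cancel] at this

theorem Reach.of_ball {g : E3 → ℝ} {v : E3 → E3} (hv : Continuous v)
    (hvlt : ∀ x : E3, g x < 0 → ‖v x‖ < 1) (hv1 : ∀ y, g y ≤ 0 → ‖v y‖ ≤ 1)
    {c a b : E3} {r : ℝ} (h : ∀ y ∈ Metric.ball c r, g y < 0) (ha : a ∈ Metric.ball c r)
    (hb : b ∈ Metric.ball c r) : Reach g v a b :=
  Reach.of_segment hv hvlt hv1 fun _ hs =>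
    h _ ((convex_ball c r).add_smul_sub_mem ha hb hs)

theorem eventually_reach_of_neg {g : E3 → ℝ} {v : E3 → E3} (hv : Continuous v) (hg : Continuous g)
    (hvlt : ∀ x : E3, g x < 0 → ‖v x‖ < 1) (hv1 : ∀ y, g y ≤ 0 → ‖v y‖ ≤ 1)
    {x₀ : E3} (h : g x₀ < 0) : ∀ᶠ y in 𝓝 x₀, Reach g v x₀ y ∧ Reach g v y x₀ := by
  obtain ⟨r, hr, hball⟩ := Metric.eventually_nhds_iff_ball.1
    (hg.continuousAt.eventually (gt_mem_nhds h))
  filter_upwards [Metric.ball_mem_nhds x₀ hr] with y hy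
  have hx := Metric.mem_ball_self (x := x₀) hr
  exact ⟨Reach.of_ball hv hvlt hv1 hball hx hy, Reach.of_ball hv hvlt hv1 hball hy hx⟩

/-- Near a boundary point the domain can be entered and left at constant velocity: the directions
`s • v x₀ - k • n`, `|s| ≤ 1`, all point strictly inwards for some `k < 1`. -/
theorem eventually_reach_of_eq_zero {g : E3 → ℝ} {v : E3 → E3} (hv : Continuous v)
    (hg : Continuous g) (hvlt : ∀ x : E3, g x < 0 → ‖v x‖ < 1)
    (hv1 : ∀ y, g y ≤ 0 → ‖v y‖ ≤ 1) {x₀ : E3} (h : g x₀ = 0) (hC1 : ContDiffAt ℝ 1 g x₀)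
    (hlt : |inner ℝ (gradient g x₀) (v x₀)| < ‖gradient g x₀‖) :
    ∀ᶠ y in 𝓝[feasibleSet g] x₀, Reach g v x₀ y ∧ Reach g v y x₀ := by
  set p := gradient g x₀ with hp
  have hp0 : 0 < ‖p‖ := (abs_nonneg _).trans_lt hlt
  -- The lower bound on `k` beats the normal drift; `k < 1` leaves a margin `1 - k` for the
  -- variation of `v` near `x₀`.
  obtain ⟨k, hk, hk1⟩ := exists_between ((div_lt_one hp0).2 hlt)
  have hk0 : 0 < k := (by positivity : (0 : ℝ) ≤ _).trans_lt hk
  rw [div_lt_iff₀ hp0] at hk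
  set n := ‖p‖⁻¹ • p with hn
  have hn1 : ‖n‖ = 1 := by
    rw [hn, norm_smul, norm_inv, norm_norm, inv_mul_cancel₀ hp0.ne']
  have hkn : ‖k • n‖ = k := by rw [norm_smul, hn1, mul_one, Real.norm_of_nonneg hk0.le]
  have hpn : inner ℝ p n = ‖p‖ := by
    rw [hn, inner_smul_right, real_inner_self_eq_norm_sq]
    field_simp
  set δ := k * ‖p‖ - |inner ℝ p (v x₀)| with hδ
  have hδ0 : 0 < δ := sub_pos.2 hk
  -- `ω 1` is the velocity of leaving inwards under the control `-k • n`; `-ω (-1)` is that of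
  -- arriving from inside under `k • n`.
  set ω : ℝ → E3 := fun s => s • v x₀ - k • n with hω
  have hωnorm : ∀ s, |s| ≤ 1 → ‖ω s‖ ≤ 2 := by
    intro s hs
    refine (norm_sub_le _ _).trans ?_
    rw [hkn, norm_smul, Real.norm_eq_abs]
    have := mul_le_one₀ hs (norm_nonneg _) (hv1 x₀ h.le)
    linarith
  have hωin : ∀ s, |s| ≤ 1 → inner ℝ p (ω s) ≤ -δ := by
    intro s hs
    rw [hω, inner_sub_right, inner_smul_right, inner_smul_right, hpn]
    have h1 := le_abs_self (s * inner ℝ p (v x₀))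
    rw [abs_mul] at h1
    have h2 := mul_le_of_le_one_left (abs_nonneg (inner ℝ p (v x₀))) hs
    linarith
  obtain ⟨r, hr, hstrict, hvr⟩ : ∃ r > 0,
      (∀ a ∈ Metric.ball x₀ r, ∀ b ∈ Metric.ball x₀ r,
        ‖g a - g b - inner ℝ p (a - b)‖ ≤ δ / 4 * ‖a - b‖) ∧
      ∀ y ∈ Metric.ball x₀ r, ‖v y - v x₀‖ ≤ 1 - k := by
    have h1 := (hC1.hasStrictFDerivAt one_ne_zero).isLittleO.def (by positivity : 0 < δ / 4)
    obtain ⟨r₁, hr₁, h1⟩ := Metric.eventually_nhds_iff_ball.1 h1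
    obtain ⟨r₂, hr₂, h2⟩ := Metric.continuousAt_iff.1 (hv.continuousAt (x := x₀)) (1 - k)
      (sub_pos.2 hk1)
    refine ⟨min r₁ r₂, lt_min hr₁ hr₂, fun a ha b hb => ?_, fun y hy => ?_⟩
    · have hab : (a, b) ∈ Metric.ball (x₀, x₀) r₁ := by
        rw [← ball_prod_same]
        exact ⟨Metric.ball_subset_ball (min_le_left _ _) ha,
          Metric.ball_subset_ball (min_le_left _ _) hb⟩
      have := h1 _ hab
      rwa [hp, gradient, InnerProductSpace.toDual_symm_apply]
    · rw [← dist_eq_norm]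
      exact (h2 (lt_of_lt_of_le hy (min_le_right _ _))).le
  have hin : ∀ s, |s| ≤ 1 → ∀ b ∈ Metric.ball x₀ (r / 2), ∀ t ∈ Icc 0 (r / 4),
      b + t • ω s ∈ Metric.ball x₀ r := by
    intro s hs b hb t ht
    rw [mem_ball_iff_norm] at hb ⊢
    have h1 : ‖b + t • ω s - x₀‖ ≤ ‖b - x₀‖ + ‖t • ω s‖ := by
      rw [add_sub_right_comm]
      exact norm_add_le _ _
    have h2 : ‖t • ω s‖ ≤ r / 4 * 2 := by
      rw [norm_smul, Real.norm_of_nonneg ht.1]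
      exact mul_le_mul ht.2 (hωnorm s hs) (norm_nonneg _) (by positivity)
    linarith
  -- The linear decrease is at least `t * δ`; as `‖ω s‖ ≤ 2`, the error `δ / 4 * ‖t • ω s‖` uses up
  -- at most half of it.
  have hdesc : ∀ s, |s| ≤ 1 → ∀ b ∈ Metric.ball x₀ (r / 2), ∀ t ∈ Icc 0 (r / 4),
      g (b + t • ω s) ≤ g b - t * (δ / 2) := by
    intro s hs b hb t ht
    have h1 := hstrict _ (hin s hs b hb t ht) b (Metric.ball_subset_ball (by linarith) hb)
    rw [add_sub_cancel_left, inner_smul_right, norm_smul, Real.norm_of_nonneg ht.1,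
      Real.norm_eq_abs] at h1
    have h2 := (abs_le.1 h1).2
    have h3 := mul_le_mul_of_nonneg_left (hωin s hs) ht.1
    have h4 := mul_le_mul_of_nonneg_left (hωnorm s hs) (mul_nonneg ht.1 hδ0.le)
    nlinarith
  have hvel₁ : ∀ y ∈ Metric.ball x₀ r, ‖ω 1 - v y‖ ≤ 1 := by
    intro y hy
    calc ‖ω 1 - v y‖ = ‖-(v y - v x₀) - k • n‖ := by rw [hω]; congr 1; module
      _ ≤ ‖v y - v x₀‖ + ‖k • n‖ := (norm_sub_le _ _).trans_eq (by rw [norm_neg])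
      _ ≤ 1 := by linarith [hvr y hy]
  have hvel₂ : ∀ y ∈ Metric.ball x₀ r, ‖-ω (-1) - v y‖ ≤ 1 := by
    intro y hy
    calc ‖-ω (-1) - v y‖ = ‖k • n - (v y - v x₀)‖ := by rw [hω]; congr 1; module
      _ ≤ ‖k • n‖ + ‖v y - v x₀‖ := norm_sub_le _ _
      _ ≤ 1 := by linarith [hvr y hy]
  have habs₁ : |(1 : ℝ)| ≤ 1 := by simp
  have habs₂ : |(-1 : ℝ)| ≤ 1 := by simp
  set τ := r / 4 with hτ
  have hτ0 : 0 < τ := by positivity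
  have hτmem : τ ∈ Icc 0 τ := ⟨hτ0.le, le_rfl⟩
  have hx₀ : x₀ ∈ Metric.ball x₀ (r / 2) := Metric.mem_ball_self (by positivity)
  have hneg : ∀ s, |s| ≤ 1 → g (x₀ + τ • ω s) < 0 := by
    intro s hs
    have := hdesc s hs x₀ hx₀ τ hτmem
    have := mul_pos hτ0 hδ0
    linarith
  obtain ⟨ρ₁, hρ₁, hball₁⟩ := Metric.eventually_nhds_iff_ball.1
    (hg.continuousAt.eventually (gt_mem_nhds (hneg 1 habs₁)))
  obtain ⟨ρ₂, hρ₂, hball₂⟩ := Metric.eventually_nhds_iff_ball.1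
    (hg.continuousAt.eventually (gt_mem_nhds (hneg (-1) habs₂)))
  have hexit : ∀ y ∈ Metric.ball x₀ (min (r / 2) (min ρ₁ ρ₂)), g y ≤ 0 →
      Reach g v y (x₀ + τ • ω 1) := by
    intro y hy hgy
    have hyr := Metric.ball_subset_ball (min_le_left _ _) hy
    have h1 := Reach.of_const_velocity hv1 (a := y) (w := ω 1) hτ0.le
      (fun t ht => (hdesc 1 habs₁ y hyr t ht).trans (by
        have := mul_nonneg ht.1 hδ0.le
        linarith))
      (fun t ht => hvel₁ _ (hin 1 habs₁ y hyr t ht))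
    refine h1.trans (Reach.of_ball hv hvlt hv1 hball₁ ?_ (Metric.mem_ball_self hρ₁))
    rw [Metric.mem_ball, dist_add_right]
    exact hy.trans_le ((min_le_right _ _).trans (min_le_left _ _))
  have henter : ∀ y ∈ Metric.ball x₀ (min (r / 2) (min ρ₁ ρ₂)), g y ≤ 0 →
      Reach g v (x₀ + τ • ω (-1)) y := by
    intro y hy hgy
    have hyr := Metric.ball_subset_ball (min_le_left _ _) hy
    have hpos : ∀ t : ℝ, y + τ • ω (-1) + t • (-ω (-1)) = y + (τ - t) • ω (-1) := by
      intro t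
      module
    have hmem : ∀ t ∈ Icc 0 τ, τ - t ∈ Icc 0 τ := fun t ht =>
      ⟨sub_nonneg.2 ht.2, sub_le_self _ ht.1⟩
    have h1 := Reach.of_const_velocity hv1 (a := y + τ • ω (-1)) (w := -ω (-1)) hτ0.le
      (fun t ht => by
        rw [hpos]
        refine (hdesc (-1) habs₂ y hyr _ (hmem t ht)).trans ?_
        have := mul_nonneg (hmem t ht).1 hδ0.le
        linarith)
      (fun t ht => by
        rw [hpos]
        exact hvel₂ _ (hin (-1) habs₂ y hyr _ (hmem t ht)))
    rw [hpos, sub_self, zero_smul, add_zero] at h1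
    refine (Reach.of_ball hv hvlt hv1 hball₂ (Metric.mem_ball_self hρ₂) ?_).trans h1
    rw [Metric.mem_ball, dist_add_right]
    exact hy.trans_le ((min_le_right _ _).trans (min_le_right _ _))
  -- The segment between the two interior points consists of points `x₀ + τ • ω s` with `|s| ≤ 1`,
  -- where `g < 0`.
  have hcross : Reach g v (x₀ + τ • ω 1) (x₀ + τ • ω (-1)) := by
    refine Reach.of_segment hv hvlt hv1 fun s hs => ?_
    have : x₀ + τ • ω 1 + s • (x₀ + τ • ω (-1) - (x₀ + τ • ω 1)) = x₀ + τ • ω (1 - 2 * s) := by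
      simp only [hω]
      module
    rw [this]
    exact hneg _ (abs_le.2 ⟨by linarith [hs.2], by linarith [hs.1]⟩)
  have hmin : 0 < min (r / 2) (min ρ₁ ρ₂) := lt_min (by positivity) (lt_min hρ₁ hρ₂)
  have hself := Metric.mem_ball_self (x := x₀) hmin
  filter_upwards [mem_nhdsWithin_of_mem_nhds (Metric.ball_mem_nhds x₀ hmin),
    self_mem_nhdsWithin] with y hy hgy
  exact ⟨(hexit x₀ hself h.le).trans (hcross.trans (henter y hy hgy)),
    (hexit y hy hgy).trans (hcross.trans (henter x₀ hself h.le))⟩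

/-! ### Existence of a minimizer -/

/-- Compactness of feasible trajectories: the minimal duration is attained, at a pointwise limit
of a minimizing sequence along an ultrafilter. -/
theorem exists_isTrajectory_minimal {g : E3 → ℝ} {v : E3 → E3} (hv : Continuous v)
    (hg : Continuous g) {a b : E3} (hab : Reach g v a b) :
    ∃ T x, IsTrajectory g v a b T x ∧ ∀ T' x', IsTrajectory g v a b T' x' → T ≤ T' := by
  set S : Set ℝ := {T | ∃ x, IsTrajectory g v a b T x} with hS
  have hbdd : BddBelow S := ⟨0, fun T ⟨_, hx⟩ => hx.time_nonneg⟩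
  obtain ⟨τ, -, hlim, hmem⟩ := exists_seq_tendsto_sInf (S := S) hab hbdd
  choose X hX using hmem
  set T := sInf S with hT
  have hTτ : ∀ n, T ≤ τ n := fun n => csInf_le hbdd ⟨X n, hX n⟩
  have hT0 : 0 ≤ T := le_csInf hab fun T ⟨_, hx⟩ => hx.time_nonneg
  have hsub : ∀ n, Icc 0 T ⊆ Icc 0 (τ n) := fun n => Icc_subset_Icc le_rfl (hTτ n)
  set U := hyperfilter ℕ with hU
  -- Along one ultrafilter the bounded values converge at every `t` simultaneously, without
  -- extracting subsequences.
  have hex : ∀ t ∈ Icc 0 T, ∃ z, Tendsto (fun n => X n t) U (𝓝 z) := by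
    intro t ht
    have hcpt := isCompact_iff_ultrafilter_le_nhds'.1 (isCompact_closedBall a (2 * T))
      (U.map fun n => X n t) (Ultrafilter.mem_map.2 (Eventually.of_forall fun n => ?_))
    · obtain ⟨z, -, hz⟩ := hcpt
      exact ⟨z, hz⟩
    · have := (hX n).lipschitz.dist_le_mul_sub ⟨le_rfl, (hX n).time_nonneg⟩ (hsub n ht) ht.1
      rw [(hX n).initial, sub_zero, dist_comm] at this
      refine this.trans ?_
      have := ht.2
      push_cast
      linarith
  choose! x hx using hex
  have h0 : (0 : ℝ) ∈ Icc 0 T := ⟨le_rfl, hT0⟩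
  have hTT : T ∈ Icc 0 T := ⟨hT0, le_rfl⟩
  have hlip : LipschitzOnWith 2 x (Icc 0 T) := by
    refine LipschitzOnWith.of_dist_le_mul_sub fun s hs t ht hst => ?_
    exact le_of_tendsto ((hx s hs).dist (hx t ht)) (Eventually.of_forall fun n =>
      (hX n).lipschitz.dist_le_mul_sub (hsub n hs) (hsub n ht) hst)
  have hslope : ∀ s ∈ Icc 0 T, ∀ ε > 0, ∃ η > 0, ∀ t ∈ Icc 0 T, s ≤ t → t < s + η →
      ‖x t - x s - (t - s) • v (x s)‖ ≤ (1 + ε) * (t - s) := by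
    intro s hs ε hε
    obtain ⟨ρ, hρ, hvρ⟩ := Metric.continuousAt_iff.1 (hv.continuousAt (x := x s)) ε hε
    -- For `n` large in `U`, `X n s` is within `ρ / 2` of `x s`, and in time `ρ / 4` at speed 2 the
    -- curve moves at most another `ρ / 2`.
    refine ⟨ρ / 4, by positivity, fun t ht hst htη => ?_⟩
    refine le_of_tendsto (((hx t ht).sub (hx s hs)).sub_const _).norm ?_
    filter_upwards [(hx s hs).eventually (Metric.ball_mem_nhds _ (half_pos hρ))] with n hn
    have hac : AbsolutelyContinuousOnInterval (X n) 0 (τ n) := by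
      refine LipschitzOnWith.absolutelyContinuousOnInterval (K := 2) ?_
      rw [uIcc_of_le (hX n).time_nonneg]
      exact (hX n).lipschitz
    refine norm_sub_sub_smul_le_of_ae_velocity hac (hX n).velocity hs.1 hst
      (ht.2.trans (hTτ n)) fun r hr => ?_
    rw [← dist_eq_norm]
    refine (hvρ ?_).le
    have hrT : r ∈ Icc 0 T := ⟨hs.1.trans hr.1, hr.2.trans ht.2⟩
    have h1 := (hX n).lipschitz.dist_le_mul_sub (hsub n hs) (hsub n hrT) hr.1
    rw [dist_comm] at h1
    have h2 := dist_triangle (X n r) (X n s) (x s)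
    have h3 : dist (X n s) (x s) < ρ / 2 := hn
    have h4 := hr.2
    push_cast at h1
    linarith
  refine ⟨T, x, ⟨hT0, hlip, ?_, ?_, ?_, ?_⟩, fun T' x' h' => csInf_le hbdd ⟨x', h'⟩⟩
  · have hne : ∀ᵐ t : ℝ, t ≠ 0 ∧ t ≠ T := by
      have h1 : ∀ᵐ t : ℝ, t ≠ 0 := by simp [ae_iff]
      have h2 : ∀ᵐ t : ℝ, t ≠ T := by simp [ae_iff]
      exact h1.and h2
    have hdiff := hlip.ae_differentiableWithinAt_of_mem_real
    rw [ae_restrict_iff' measurableSet_Icc]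
    filter_upwards [hdiff, hne] with s hs hsne hmem
    have hs0 : 0 < s := lt_of_le_of_ne hmem.1 hsne.1.symm
    have hsT : s < T := lt_of_le_of_ne hmem.2 hsne.2
    have hd := ((hs hmem).differentiableAt (Icc_mem_nhds hs0 hsT)).hasDerivAt
    refine ⟨_, hd, le_of_forall_pos_le_add fun ε hε => ?_⟩
    obtain ⟨η, hη, hbound⟩ := hslope s hmem ε hε
    -- The derivative exists, so right slopes alone determine it.
    have hd' := (hasDerivAt_iff_tendsto_slope.1 hd).mono_left
      (nhdsWithin_mono s fun t (ht : s < t) => ne_of_gt ht : 𝓝[>] s ≤ 𝓝[≠] s)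
    refine le_of_tendsto (hd'.sub_const (v (x s))).norm ?_
    have hev : ∀ᶠ t in 𝓝[>] s, t < min (s + η) T :=
      mem_nhdsWithin_of_mem_nhds (gt_mem_nhds (lt_min (by linarith) hsT))
    filter_upwards [hev, self_mem_nhdsWithin] with t ht hst
    have hst' : 0 < t - s := sub_pos.2 hst
    have h1 := hbound t ⟨hs0.le.trans (le_of_lt hst), (ht.trans_le (min_le_right _ _)).le⟩
      (le_of_lt hst) (ht.trans_le (min_le_left _ _))
    have h2 : x t - x s - (t - s) • v (x s) = (t - s) • (slope x s t - v (x s)) := by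
      rw [slope_def_module, smul_sub, smul_inv_smul₀ hst'.ne']
    rw [h2, norm_smul, Real.norm_of_nonneg hst'.le, mul_comm] at h1
    exact le_of_mul_le_mul_right h1 hst'
  · refine tendsto_nhds_unique (hx 0 h0) ?_
    simp [(hX _).initial]
  · refine tendsto_nhds_unique (hx T hTT) ?_
    rw [tendsto_iff_dist_tendsto_zero]
    have hlimU : Tendsto (fun n => 2 * (τ n - T)) U (𝓝 0) := by
      have := ((hlim.sub_const T).const_mul 2).mono_left Nat.hyperfilter_le_atTop
      simpa using this
    refine squeeze_zero (fun n => dist_nonneg) (fun n => ?_) hlimU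
    -- `X n` reaches `b` only at `τ n ≥ T`; at time `T` it is within `2 * (τ n - T)` of `b`.
    have := (hX n).lipschitz.dist_le_mul_sub (hsub n hTT) ⟨(hX n).time_nonneg, le_rfl⟩ (hTτ n)
    rwa [(hX n).terminal] at this
  · intro t ht
    exact le_of_tendsto ((hg.tendsto _).comp (hx t ht)) (Eventually.of_forall fun n =>
      (hX n).state_mem t (hsub n ht))

theorem proposition1 (g : E3 → ℝ) (v : E3 → E3) (A B : E3)
    (hv : ContDiff ℝ 1 v)
    (hg : Continuous g)
    (hgC1 : ∀ x : E3, g x = 0 → ContDiffAt ℝ 1 g x)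
    (hgrad : ∀ x : E3, g x = 0 → gradient g x ≠ 0)
    (hreg : RegularityCondition g v)
    (hvlt : ∀ x : E3, g x < 0 → ‖v x‖ < 1)
    (hAB : B ∈ connectedComponentIn (feasibleSet g) A) :
    ∃ (T : ℝ) (x u : ℝ → E3), IsOptimalProcess g v A B T x u := by
  have hvc := hv.continuous
  have hv1 : ∀ y, g y ≤ 0 → ‖v y‖ ≤ 1 := fun y => norm_drift_le_one hvc hgrad hvlt
  have hA : A ∈ feasibleSet g := connectedComponentIn_nonempty_iff.1 ⟨B, hAB⟩
  have hreach : Reach g v A B := by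
    refine isPreconnected_connectedComponentIn.induction₂' (Reach g v) (fun x hx => ?_)
      (fun _ _ _ _ _ _ h h' => h.trans h') (mem_connectedComponentIn hA) hAB
    have hxD : x ∈ feasibleSet g := connectedComponentIn_subset _ _ hx
    change g x ≤ 0 at hxD
    rcases hxD.lt_or_eq with h | h
    · exact nhdsWithin_le_nhds (eventually_reach_of_neg hvc hg hvlt hv1 h)
    · exact nhdsWithin_mono x (connectedComponentIn_subset _ _)
        (eventually_reach_of_eq_zero hvc hg hvlt hv1 h (hgC1 x h)
          (hreg.abs_inner_gradient_lt h (hgrad x h) (hv1 x hxD)))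
  obtain ⟨T, x, hx, hmin⟩ := exists_isTrajectory_minimal hvc hg hreach
  obtain ⟨u, hu⟩ := hx.exists_isFeasibleProcess hvc
  exact ⟨T, x, u, hu, fun T' x' u' h' => hmin T' x' (h'.isTrajectory hv1)⟩
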